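/- **Lemma (Nonlinear monogamy of entanglement on a star).** Let $G=(V,E,w)$ be a finite simple graph with positive edge weights, $n=|V|$, with one qubit at each vertex, and let $X_i,Y_i,Z_i$ be the Pauli matrices acting on qubit $i$. For $i\ne j$ put $$h_{ij}=\tfrac12\,(I+X_iX_j-Y_iY_j+Z_iZ_j),\qquad H(G)=\sum_{(i,j)\in E}w_{ij}h_{ij}.$$ Let $i\in V$ have degree $d_i\ge 2$, let $N(i)$ be its set of neighbours, and let $j\in N(i)$. We say that real numbers $g$ satisfy the *star bound* at $(i,j)$ if $-1\le g_{ij}\le 1$ and $$\sum_{k\in N(i)\setminus\{j\}} g_{ik}\;\le\;\begin{cases}1, & \text{if } -1\le g_{ij}<-\frac1{d_i},\\[2pt] \frac12\Big(2-d_i-g_{ij}+\sqrt{(d_i^2-1)(1-g_{ij}^2)}\Big), & \text{if } -\frac1{d_i}\le g_{ij}\le 1.\end{cases}$$ 1. For every unit vector $|\psi\rangle\in(\mathbb C^2)^{\otimes V}$, the values $g_{ij}=\langle\psi|h_{ij}|\psi\rangle-1$ satisfy the star bound at $(i,j)$. 2. For $k\ge 0$ let $\mathcal P_k$ be the set of Pauli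 monomials on the $n$ qubits with at most $k$ non-identity factors, and let $\mathcal M_k$ be the set of real symmetric matrices $\Gamma\in\mathbb R^{\mathcal P_k\times\mathcal P_k}$ such that $\Gamma\succeq0$; $\Gamma(A,A)=1$ for all $A\in\mathcal P_k$; $\Gamma(A,B)=\Gamma(A',B')$ whenever $AB=A'B'$; $\Gamma(A,B)=-\Gamma(A',B')$ whenever $AB=-A'B'$; and $\Gamma(A,B)=0$ whenever $AB$ is not Hermitian. For $\Gamma\in\mathcal M_k$ let $L$ be the real linear functional on $\mathrm{span}_{\mathbb R}\,\mathcal P_{2k}$ with $L(C)=\Gamma(A,B)$ whenever $C=AB$ with $A,B\in\mathcal P_k$, and put $$g_{ij}=\tfrac12\big(-1+L(X_iX_j)-L(Y_iY_j)+L(Z_iZ_j)\big).$$ Then for every $k\ge2$ and every $\Gamma\in\mathcal M_k$ the values $g$ satisfy the star bound at $(i,j)$. In particular this holds for every optimal solution $\Gamma$ of the level-$k$ quantum moment-SoS relaxation $\max\{L(H(G)) : \Gamma\in\mathcal M_k\}$. -/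

import Mathlib

/-! ### Pauli operators on qubits labelled by a finite type `V`

The Hilbert space of the qubits has the computational basis `V → Fin 2`; operators are complex
matrices indexed by this basis. -/

/-- The labels of the four single-qubit Pauli matrices. -/
inductive PauliLabel
  | I
  | X
  | Y
  | Z
  deriving DecidableEq

instance : Fintype PauliLabel :=
  ⟨{.I, .X, .Y, .Z}, by intro a; cases a <;> simp⟩

/-- The single-qubit Pauli matrices. -/
noncomputable def PauliLabel.mat : PauliLabel → Matrix (Fin 2) (Fin 2) ℂ
  | .I => !![1, 0; 0, 1]
  | .X => !![0, 1; 1, 0]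
  | .Y => !![0, -Complex.I; Complex.I, 0]
  | .Z => !![1, 0; 0, -1]

/-- Operators on the space of the qubits `V`. -/
abbrev QubitOp (V : Type*) : Type _ := Matrix (V → Fin 2) (V → Fin 2) ℂ

/-- The tensor product, over all qubits, of single-qubit operators. -/
noncomputable def qubitTensor {V : Type*} [Fintype V] (M : V → Matrix (Fin 2) (Fin 2) ℂ) :
    QubitOp V :=
  Matrix.of fun x y => ∏ v, M v (x v) (y v)

/-- The operator of a Pauli string. -/
noncomputable def pauliOp {V : Type*} [Fintype V] (s : V → PauliLabel) : QubitOp V :=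
  qubitTensor fun v => (s v).mat

/-- The Pauli matrix with label `a` acting on qubit `i` (and the identity elsewhere). -/
noncomputable def siteOp {V : Type*} [Fintype V] [DecidableEq V] (a : PauliLabel) (i : V) :
    QubitOp V :=
  pauliOp (Function.update (fun _ => PauliLabel.I) i a)

/-- The set `𝒫ₖ` of Pauli monomials with at most `k` non-identity factors, as strings. -/
abbrev PauliMonomial (V : Type*) [Fintype V] (k : ℕ) : Type _ :=
  {s : V → PauliLabel // (Finset.univ.filter fun v => s v ≠ PauliLabel.I).card ≤ k}

/-- The real span `𝒪ₖ` of `𝒫ₖ`. -/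
noncomputable def pauliSpan (V : Type*) [Fintype V] (k : ℕ) : Submodule ℝ (QubitOp V) :=
  Submodule.span ℝ (Set.range fun A : PauliMonomial V k => pauliOp A.1)

/-! ### The EPR Hamiltonian -/

/-- The edge term `h_ij = (I + X_i X_j - Y_i Y_j + Z_i Z_j) / 2`. -/
noncomputable def eprTerm {V : Type*} [Fintype V] [DecidableEq V] (i j : V) : QubitOp V :=
  (1 / 2 : ℝ) • (1 + siteOp .X i * siteOp .X j - siteOp .Y i * siteOp .Y j
    + siteOp .Z i * siteOp .Z j)

theorem qubitTensor_mul {V : Type*} [Fintype V] [DecidableEq V]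
    (M N : V → Matrix (Fin 2) (Fin 2) ℂ) :
    qubitTensor M * qubitTensor N = qubitTensor fun v => M v * N v := by
  ext x y
  simp only [qubitTensor, Matrix.mul_apply, Matrix.of_apply, ← Finset.prod_mul_distrib]
  rw [Finset.prod_univ_sum, Fintype.piFinset_univ]

theorem siteOp_mul_comm {V : Type*} [Fintype V] [DecidableEq V] (a : PauliLabel) (i j : V) :
    siteOp a i * siteOp a j = siteOp a j * siteOp a i := by
  simp only [siteOp, pauliOp, qubitTensor_mul]
  congr 1
  funext v
  have h1 : PauliLabel.I.mat = 1 := by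
    ext p q; fin_cases p <;> fin_cases q <;> simp [PauliLabel.mat]
  simp only [Function.update_apply]
  split_ifs <;> simp [h1]

theorem eprTerm_comm {V : Type*} [Fintype V] [DecidableEq V] (i j : V) :
    eprTerm i j = eprTerm j i := by
  simp only [eprTerm, siteOp_mul_comm _ i j]

/-- The EPR Hamiltonian `H(G) = ∑_{(i,j) ∈ E} w_ij h_ij` of a weighted graph. -/
noncomputable def eprHamiltonian {V : Type*} [Fintype V] [DecidableEq V] (G : SimpleGraph V)
    [DecidableRel G.Adj] (w : Sym2 V → ℝ) : QubitOp V :=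
  ∑ e ∈ G.edgeFinset, w e • Sym2.lift ⟨eprTerm, eprTerm_comm⟩ e

/-- The value `g_ij = ⟨ψ| h_ij |ψ⟩ - 1` of a state vector `ψ`. -/
noncomputable def stateValue {V : Type*} [Fintype V] [DecidableEq V]
    (ψ : EuclideanSpace ℂ (V → Fin 2)) (i j : V) : ℝ :=
  (star ψ.ofLp ⬝ᵥ (eprTerm i j).mulVec ψ.ofLp).re - 1

/-! ### The quantum moment-SoS hierarchy -/

/-- Membership in the set `ℳₖ` of level-`k` moment matrices. (`Matrix.PosSemidef` includes
symmetry.) -/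
structure IsMomentMatrix {V : Type*} [Fintype V] [DecidableEq V] {k : ℕ}
    (Γ : Matrix (PauliMonomial V k) (PauliMonomial V k) ℝ) : Prop where
  posSemidef : Γ.PosSemidef
  eq_of_mul_eq : ∀ A B A' B' : PauliMonomial V k,
    pauliOp A.1 * pauliOp B.1 = pauliOp A'.1 * pauliOp B'.1 → Γ A B = Γ A' B'
  eq_neg_of_mul_eq_neg : ∀ A B A' B' : PauliMonomial V k,
    pauliOp A.1 * pauliOp B.1 = -(pauliOp A'.1 * pauliOp B'.1) → Γ A B = -Γ A' B'
  eq_zero : ∀ A B : PauliMonomial V k, ¬ (pauliOp A.1 * pauliOp B.1).IsHermitian → Γ A B = 0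
  diag : ∀ A : PauliMonomial V k, Γ A A = 1

open Classical in
/-- The value `L(P)` on a Pauli string `P`: it is `Γ(A,B)` for a factorization `P = A B` with
`A, B ∈ 𝒫ₖ`. -/
noncomputable def pauliMoment {V : Type*} [Fintype V] [DecidableEq V] {k : ℕ}
    (Γ : Matrix (PauliMonomial V k) (PauliMonomial V k) ℝ) (P : V → PauliLabel) : ℝ :=
  if h : ∃ AB : PauliMonomial V k × PauliMonomial V k,
      pauliOp AB.1.1 * pauliOp AB.2.1 = pauliOp P
  then Γ h.choose.1 h.choose.2 else 0

/-- The pseudo-expectation `L` of a moment matrix: the real linear functional on `𝒪₂ₖ` with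
`L(C) = Γ(A,B)` whenever `C = A B` with `A, B ∈ 𝒫ₖ` (see `pseudoExpectation_eq`). The coefficient
of the Pauli string `P` in an operator `C` is `tr(P C) / 2 ^ n`; through this formula `L` is
written as a functional on all operators, but only its values on `𝒪₂ₖ` matter. -/
noncomputable def pseudoExpectation {V : Type*} [Fintype V] [DecidableEq V] {k : ℕ}
    (Γ : Matrix (PauliMonomial V k) (PauliMonomial V k) ℝ) (C : QubitOp V) : ℝ :=
  ∑ P : PauliMonomial V (2 * k),
    ((pauliOp P.1 * C).trace.re / 2 ^ Fintype.card V) * pauliMoment Γ P.1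

theorem pseudoExpectation_add {V : Type*} [Fintype V] [DecidableEq V] {k : ℕ}
    (Γ : Matrix (PauliMonomial V k) (PauliMonomial V k) ℝ) (C D : QubitOp V) :
    pseudoExpectation Γ (C + D) = pseudoExpectation Γ C + pseudoExpectation Γ D := by
  simp only [pseudoExpectation, ← Finset.sum_add_distrib]
  refine Finset.sum_congr rfl fun P _ => ?_
  rw [mul_add, Matrix.trace_add, Complex.add_re]
  ring

theorem pseudoExpectation_smul {V : Type*} [Fintype V] [DecidableEq V] {k : ℕ}
    (Γ : Matrix (PauliMonomial V k) (PauliMonomial V k) ℝ) (r : ℝ) (C : QubitOp V) :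
    pseudoExpectation Γ (r • C) = r * pseudoExpectation Γ C := by
  simp only [pseudoExpectation, Finset.mul_sum]
  refine Finset.sum_congr rfl fun P _ => ?_
  rw [Matrix.mul_smul, Matrix.trace_smul, Complex.smul_re, smul_eq_mul]
  ring

theorem trace_qubitTensor {V : Type*} [Fintype V] [DecidableEq V]
    (M : V → Matrix (Fin 2) (Fin 2) ℂ) : (qubitTensor M).trace = ∏ v, (M v).trace := by
  simp only [qubitTensor, Matrix.trace, Matrix.diag_apply, Matrix.of_apply]
  rw [Finset.prod_univ_sum, Fintype.piFinset_univ]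

theorem PauliLabel.trace_mul (a b : PauliLabel) :
    (a.mat * b.mat).trace = if a = b then 2 else 0 := by
  cases a <;> cases b <;> simp [PauliLabel.mat, Matrix.trace_fin_two] <;> norm_num

theorem trace_pauliOp_mul {V : Type*} [Fintype V] [DecidableEq V] (s t : V → PauliLabel) :
    (pauliOp s * pauliOp t).trace = if s = t then 2 ^ Fintype.card V else 0 := by
  rw [pauliOp, pauliOp, qubitTensor_mul, trace_qubitTensor]
  simp only [PauliLabel.trace_mul]
  split_ifs with h
  · simp [h]
  · obtain ⟨v, hv⟩ := Function.ne_iff.mp h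
    exact Finset.prod_eq_zero (Finset.mem_univ v) (by simp [hv])

theorem pseudoExpectation_pauliOp {V : Type*} [Fintype V] [DecidableEq V] {k : ℕ}
    (Γ : Matrix (PauliMonomial V k) (PauliMonomial V k) ℝ) (P : PauliMonomial V (2 * k)) :
    pseudoExpectation Γ (pauliOp P.1) = pauliMoment Γ P.1 := by
  rw [pseudoExpectation, Finset.sum_eq_single P]
  · rw [trace_pauliOp_mul, if_pos rfl]
    have : ((2 : ℂ) ^ Fintype.card V).re = 2 ^ Fintype.card V := by
      rw [← Complex.ofReal_ofNat, ← Complex.ofReal_pow, Complex.ofReal_re]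
    rw [this, div_self (by positivity), one_mul]
  · intro Q _ hQ
    rw [trace_pauliOp_mul, if_neg fun h => hQ (Subtype.ext h)]
    simp
  · simp

theorem PauliLabel.exists_mul (a b : PauliLabel) :
    ∃ (c : PauliLabel) (z : ℂ), a.mat * b.mat = z • c.mat ∧ z ^ 4 = 1 ∧
      (c ≠ .I → a ≠ .I ∨ b ≠ .I) := by
  cases a <;> cases b
  case I.I => exact ⟨.I, 1, by simp [PauliLabel.mat], by simp, by simp⟩
  case I.X => exact ⟨.X, 1, by simp [PauliLabel.mat], by simp, by simp⟩
  case I.Y => exact ⟨.Y, 1, by simp [PauliLabel.mat], by simp, by simp⟩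
  case I.Z => exact ⟨.Z, 1, by simp [PauliLabel.mat], by simp, by simp⟩
  case X.I => exact ⟨.X, 1, by simp [PauliLabel.mat], by simp, by simp⟩
  case Y.I => exact ⟨.Y, 1, by simp [PauliLabel.mat], by simp, by simp⟩
  case Z.I => exact ⟨.Z, 1, by simp [PauliLabel.mat], by simp, by simp⟩
  case X.X => exact ⟨.I, 1, by simp [PauliLabel.mat], by simp, by simp⟩
  case Y.Y => exact ⟨.I, 1, by simp [PauliLabel.mat], by simp, by simp⟩
  case Z.Z => exact ⟨.I, 1, by simp [PauliLabel.mat], by simp, by simp⟩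
  case X.Y => exact ⟨.Z, Complex.I, by simp [PauliLabel.mat], by norm_num [pow_succ, Complex.I_mul_I, mul_assoc], by simp⟩
  case Y.X => exact ⟨.Z, -Complex.I, by simp [PauliLabel.mat], by norm_num [pow_succ, Complex.I_mul_I, mul_assoc], by simp⟩
  case Y.Z => exact ⟨.X, Complex.I, by simp [PauliLabel.mat], by norm_num [pow_succ, Complex.I_mul_I, mul_assoc], by simp⟩
  case Z.Y => exact ⟨.X, -Complex.I, by simp [PauliLabel.mat], by norm_num [pow_succ, Complex.I_mul_I, mul_assoc], by simp⟩
  case Z.X => exact ⟨.Y, Complex.I, by simp [PauliLabel.mat], by norm_num [pow_succ, Complex.I_mul_I, mul_assoc], by simp⟩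
  case X.Z => exact ⟨.Y, -Complex.I, by simp [PauliLabel.mat], by norm_num [pow_succ, Complex.I_mul_I, mul_assoc], by simp⟩

theorem exists_pauliOp_mul {V : Type*} [Fintype V] [DecidableEq V] {k : ℕ}
    (A B : PauliMonomial V k) :
    ∃ (P : PauliMonomial V (2 * k)) (z : ℂ), pauliOp A.1 * pauliOp B.1 = z • pauliOp P.1 ∧
      z ^ 4 = 1 := by
  choose c z h1 h2 h3 using PauliLabel.exists_mul
  refine ⟨⟨fun v => c (A.1 v) (B.1 v), ?_⟩, ∏ v, z (A.1 v) (B.1 v), ?_, ?_⟩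
  · have hsub : (Finset.univ.filter fun v => c (A.1 v) (B.1 v) ≠ PauliLabel.I) ⊆
        (Finset.univ.filter fun v => A.1 v ≠ PauliLabel.I) ∪
        (Finset.univ.filter fun v => B.1 v ≠ PauliLabel.I) := by
      intro v hv
      simpa using h3 _ _ (by simpa using hv)
    have := (Finset.card_le_card hsub).trans (Finset.card_union_le _ _)
    have hA := A.2
    have hB := B.2
    exact this.trans (by omega)
  · rw [pauliOp, pauliOp, qubitTensor_mul]
    ext x y
    simp [h1, pauliOp, qubitTensor, Finset.prod_mul_distrib]
  · simp [← Finset.prod_pow, h2]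

theorem exists_pauliOp_factorization {V : Type*} [Fintype V] [DecidableEq V] {k : ℕ}
    (P : PauliMonomial V (2 * k)) :
    ∃ AB : PauliMonomial V k × PauliMonomial V k,
      pauliOp AB.1.1 * pauliOp AB.2.1 = pauliOp P.1 := by
  set S := Finset.univ.filter fun v => P.1 v ≠ PauliLabel.I with hS
  have hcard : S.card ≤ 2 * k := P.2
  obtain ⟨T, hT, hTc⟩ := Finset.exists_subset_card_eq (Nat.min_le_right k S.card)
  have hI : PauliLabel.I.mat = 1 := by
    ext p q; fin_cases p <;> fin_cases q <;> simp [PauliLabel.mat]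
  refine ⟨(⟨fun v => if v ∈ T then P.1 v else .I, ?_⟩,
    ⟨fun v => if v ∈ T then .I else P.1 v, ?_⟩), ?_⟩
  · refine (Finset.card_le_card (t := T) ?_).trans (by omega)
    intro v hv
    by_contra hvT
    simp [hvT] at hv
  · refine (Finset.card_le_card (t := S \ T) ?_).trans ?_
    · intro v hv
      by_cases hvT : v ∈ T
      · simp [hvT] at hv
      · simpa [hvT, hS] using hv
    · rw [Finset.card_sdiff_of_subset hT]
      omega
  · simp only [pauliOp, qubitTensor_mul]
    congr 1
    funext v
    by_cases hvT : v ∈ T <;> simp [hvT, hI]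

theorem pauliOp_isHermitian {V : Type*} [Fintype V] (s : V → PauliLabel) :
    (pauliOp s).IsHermitian := by
  ext x y
  simp only [pauliOp, qubitTensor, Matrix.conjTranspose_apply, Matrix.of_apply, star_prod]
  refine Finset.prod_congr rfl fun v _ => ?_
  have : ((s v).mat).IsHermitian := by
    cases s v <;> ext p q <;> fin_cases p <;> fin_cases q <;> simp [PauliLabel.mat]
  exact this.apply _ _

theorem isHermitian_of_mem_pauliSpan {V : Type*} [Fintype V] {k : ℕ} {C : QubitOp V}
    (hC : C ∈ pauliSpan V k) : C.IsHermitian := by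
  refine Submodule.span_induction ?_ Matrix.isHermitian_zero (fun _ _ _ _ h h' => h.add h') ?_ hC
  · rintro _ ⟨A, rfl⟩
    exact pauliOp_isHermitian A.1
  · intro r D _ hD
    rw [Matrix.IsHermitian, Matrix.conjTranspose_smul, hD.eq, star_trivial]

/-- The defining property of the pseudo-expectation. -/
theorem pseudoExpectation_eq {V : Type*} [Fintype V] [DecidableEq V] {k : ℕ}
    {Γ : Matrix (PauliMonomial V k) (PauliMonomial V k) ℝ} (hΓ : IsMomentMatrix Γ)
    {C : QubitOp V} (hC : C ∈ pauliSpan V (2 * k)) (A B : PauliMonomial V k)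
    (hAB : C = pauliOp A.1 * pauliOp B.1) : pseudoExpectation Γ C = Γ A B := by
  obtain ⟨P, z, hz, hz4⟩ := exists_pauliOp_mul A B
  have hex := exists_pauliOp_factorization P
  have hch := hex.choose_spec
  have hmom : pauliMoment Γ P.1 = Γ hex.choose.1 hex.choose.2 := by
    rw [pauliMoment, dif_pos hex]
  have htr := trace_pauliOp_mul P.1 P.1
  rw [if_pos rfl] at htr
  have hne : pauliOp P.1 ≠ 0 := by
    intro h0
    rw [h0, zero_mul, Matrix.trace_zero] at htr
    exact pow_ne_zero _ (two_ne_zero) htr.symm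
  have hherm := isHermitian_of_mem_pauliSpan hC
  rw [hAB, hz, Matrix.IsHermitian, Matrix.conjTranspose_smul, (pauliOp_isHermitian P.1).eq] at hherm
  have hzr : star z = z := smul_left_injective ℂ hne hherm
  obtain ⟨r, rfl⟩ := Complex.conj_eq_iff_real.mp hzr
  have hr4 : r ^ 4 = 1 := by exact_mod_cast hz4
  have hr : r = 1 ∨ r = -1 := by
    have : (r - 1) * (r + 1) * (r ^ 2 + 1) = 0 := by linear_combination hr4
    rcases mul_eq_zero.mp this with h | h
    · rcases mul_eq_zero.mp h with h | h
      · left; linarith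
      · right; linarith
    · nlinarith [sq_nonneg r]
  have hL := pseudoExpectation_pauliOp Γ P
  rcases hr with rfl | rfl
  · have hz' : pauliOp A.1 * pauliOp B.1 = pauliOp P.1 := by simpa using hz
    rw [hAB, hz', hL, hmom]
    exact hΓ.eq_of_mul_eq _ _ _ _ (hch.trans hz'.symm)
  · have hz' : pauliOp A.1 * pauliOp B.1 = -pauliOp P.1 := by simpa using hz
    have hneg : -pauliOp P.1 = (-1 : ℝ) • pauliOp P.1 := by simp
    rw [hAB, hz', hneg, pseudoExpectation_smul, hL, hmom,
      hΓ.eq_neg_of_mul_eq_neg A B _ _ (hz'.trans (congrArg Neg.neg hch.symm))]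
    ring

/-- The value `g_ij = (-1 + L(X_i X_j) - L(Y_i Y_j) + L(Z_i Z_j)) / 2` of a moment matrix. -/
noncomputable def momentValue {V : Type*} [Fintype V] [DecidableEq V] {k : ℕ}
    (Γ : Matrix (PauliMonomial V k) (PauliMonomial V k) ℝ) (i j : V) : ℝ :=
  (-1 + pseudoExpectation Γ (siteOp .X i * siteOp .X j)
    - pseudoExpectation Γ (siteOp .Y i * siteOp .Y j)
    + pseudoExpectation Γ (siteOp .Z i * siteOp .Z j)) / 2

/-- `Γ` is an optimal solution of the level-`k` semidefinite program
`max L(H(G))` subject to `Γ ∈ ℳₖ`. -/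
def IsMomentSoSSolution {V : Type*} [Fintype V] [DecidableEq V] (G : SimpleGraph V)
    [DecidableRel G.Adj] (w : Sym2 V → ℝ) {k : ℕ}
    (Γ : Matrix (PauliMonomial V k) (PauliMonomial V k) ℝ) : Prop :=
  IsMomentMatrix Γ ∧ ∀ Γ' : Matrix (PauliMonomial V k) (PauliMonomial V k) ℝ, IsMomentMatrix Γ' →
    pseudoExpectation Γ' (eprHamiltonian G w) ≤ pseudoExpectation Γ (eprHamiltonian G w)

/-! ### The bound -/

/-- The nonlinear monogamy bound for edge values `g` on the star around `i` with the
distinguished neighbour `j`: the value `g_ij` lies in `[-1, 1]`, and the sum of the values on the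
other edges at `i` is bounded by the piecewise function of `g_ij`. -/
def StarMonogamyBound {V : Type*} [Fintype V] [DecidableEq V] (G : SimpleGraph V)
    [DecidableRel G.Adj] (g : V → V → ℝ) (i j : V) : Prop :=
  -1 ≤ g i j ∧ g i j ≤ 1 ∧
    ∑ k ∈ (G.neighborFinset i).erase j, g i k ≤
      if g i j < -1 / (G.degree i : ℝ) then 1
      else (1 / 2) * (2 - (G.degree i : ℝ) - g i j
        + Real.sqrt (((G.degree i : ℝ) ^ 2 - 1) * (1 - g i j ^ 2)))

/-! ### Swap-like vectors in a real inner product space -/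

/-! Conjugation by `Y` at the centre `i` turns `h_ik - I` into minus the swap of qubits `i` and `k`,
so `g_ik` is minus the value of a swap. A positive semidefinite `Γ` is a Gram matrix, and its real
inner products play the role of expectations of half anticommutators. At level 2 they contain
vectors satisfying the swap relations recorded in `IsSwapSystem`. A state gives a moment matrix
(`isMomentMatrix_stateMoment`), so both claims reduce to `IsSwapSystem.star_bound`.

Let `N` be the other neighbours, `n = |N| = d - 1`, and put `A = S i j`, `B = ∑ S i k`, `D = ∑ S j
k` over `k ∈ N`, with `a = ⟪e, A⟫` and `b = ⟪e, B⟫`. Cauchy–Schwarz for `e` and `B` gives `b ≥ -1`,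
the constant branch. The other branch is an arc of the ellipse `u ^ 2 = (d ^ 2 - 1) * (1 - a ^ 2)`,
where `u = a + 2 * b - (n - 1)`. Each needed tangent inequality `0 ≤ 1 + α * a + γ * u` has an
explicit sum-of-squares certificate in `e, A, B, D` (`tangent_bound`); the tangent at the point with
`a = -g` gives the bound. The certificate needs `α + γ ≥ 0`, which is where the threshold `-1/d`
comes from. -/

open scoped RealInnerProductSpace in
/-- Unit vectors `S a b`, one for each pair of distinct labels, whose inner products obey the
relations of the qubit swap operators in a pseudo-state with reference vector `e`. -/
structure IsSwapSystem {V E : Type*} [NormedAddCommGroup E] [InnerProductSpace ℝ E]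
    (e : E) (S : V → V → E) : Prop where
  norm_ref : ⟪e, e⟫ = 1
  symm : ∀ a b, S a b = S b a
  norm_swap : ∀ a b, a ≠ b → ⟪S a b, S a b⟫ = 1
  -- For genuine swaps, the anticommutator of `(a b)` and `(a c)` is `(a b) + (a c) + (b c) - 1` on
  -- qubits, since the antisymmetrizer of three qubits vanishes.
  triangle : ∀ a b c, a ≠ b → a ≠ c → b ≠ c →
    2 * ⟪S a b, S a c⟫ = ⟪e, S a b⟫ + ⟪e, S a c⟫ + ⟪e, S b c⟫ - 1

namespace IsSwapSystem

open scoped RealInnerProductSpace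

variable {V E : Type*} [NormedAddCommGroup E] [InnerProductSpace ℝ E] {e : E} {S : V → V → E}

theorem abs_inner_le_one (h : IsSwapSystem e S) {a b : V} (hab : a ≠ b) : |⟪e, S a b⟫| ≤ 1 := by
  have h1 : ‖e‖ = 1 := by
    have := h.norm_ref
    rwa [real_inner_self_eq_norm_sq, pow_eq_one_iff_of_nonneg
      (norm_nonneg e) two_ne_zero] at this
  have h2 : ‖S a b‖ = 1 := by
    have := h.norm_swap a b hab
    rwa [real_inner_self_eq_norm_sq, pow_eq_one_iff_of_nonneg
      (norm_nonneg (S a b)) two_ne_zero] at this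
  simpa [h1, h2] using abs_real_inner_le_norm e (S a b)

/-- The defect of the sum of all swaps among the labels in `N` from its maximal value. -/
noncomputable def defect [DecidableEq V] (e : E) (S : V → V → E) (N : Finset V) : ℝ :=
  (1 / 2) * ∑ k ∈ N, ∑ l ∈ N, if k = l then 0 else 1 - ⟪e, S k l⟫

theorem defect_nonneg [DecidableEq V] (h : IsSwapSystem e S) (N : Finset V) :
    0 ≤ defect e S N := by
  refine mul_nonneg (by norm_num) (Finset.sum_nonneg fun k _ => Finset.sum_nonneg fun l _ => ?_)
  split_ifs with hkl
  · exact le_rfl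
  · linarith [(abs_le.mp (h.abs_inner_le_one hkl)).2]

/-- Expand the square: `norm_swap` handles the diagonal, and the triangle relation handles the rest.
The swaps `S k l` inside `N` enter only through the defect, whose sign is known. -/
theorem inner_star_self [DecidableEq V] (h : IsSwapSystem e S) {i : V} {N : Finset V}
    (hi : i ∉ N) :
    ⟪∑ k ∈ N, S i k, ∑ k ∈ N, S i k⟫ =
      N.card + (N.card - 1) * ⟪e, ∑ k ∈ N, S i k⟫ - defect e S N := by
  have key : ∀ k ∈ N, ∀ l ∈ N, ⟪S i k, S i l⟫ =
      (1 / 2) * ⟪e, S i k⟫ + (1 / 2) * ⟪e, S i l⟫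
        - (1 / 2) * (if k = l then 0 else 1 - ⟪e, S k l⟫)
        + if k = l then 1 - ⟪e, S i k⟫ else 0 := by
    intro k hk l hl
    have hik : i ≠ k := fun hh => hi (hh ▸ hk)
    have hil : i ≠ l := fun hh => hi (hh ▸ hl)
    by_cases hkl : k = l
    · subst hkl
      simp only [if_true]
      rw [h.norm_swap i k hik]
      ring
    · simp only [hkl, if_false]
      linarith [h.triangle i k l hik hil hkl]
  rw [sum_inner]
  simp only [inner_sum]
  rw [Finset.sum_congr rfl fun k hk => Finset.sum_congr rfl fun l hl => key k hk l hl]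
  simp only [Finset.sum_add_distrib, Finset.sum_sub_distrib, Finset.sum_const, nsmul_eq_mul,
    Finset.sum_ite_eq, ← Finset.mul_sum, defect]
  rw [Finset.sum_congr rfl (g := fun k => 1 - ⟪e, S i k⟫) fun k hk => if_pos hk]
  simp only [Finset.sum_sub_distrib, Finset.sum_const, nsmul_eq_mul]
  ring

/-- Summing the triangles `i, j, k` brings in the star centred at `j`; the certificate below must
therefore use both stars. -/
theorem inner_swap_star (h : IsSwapSystem e S) {i j : V} (hij : i ≠ j)
    {N : Finset V} (hi : i ∉ N) (hj : j ∉ N) :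
    2 * ⟪S i j, ∑ k ∈ N, S i k⟫ =
      N.card * (⟪e, S i j⟫ - 1) + ⟪e, ∑ k ∈ N, S i k⟫ + ⟪e, ∑ k ∈ N, S j k⟫ := by
  simp only [inner_sum, Finset.mul_sum]
  rw [Finset.sum_congr rfl fun k hk =>
    h.triangle i j k hij (fun hh => hi (hh ▸ hk)) (fun hh => hj (hh ▸ hk))]
  simp only [Finset.sum_add_distrib, Finset.sum_sub_distrib, Finset.sum_const, nsmul_eq_mul]
  ring

theorem neg_one_le_inner_star [DecidableEq V] (h : IsSwapSystem e S) {i : V} {N : Finset V}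
    (hi : i ∉ N) : -1 ≤ ⟪e, ∑ k ∈ N, S i k⟫ := by
  have hB := h.inner_star_self hi
  have hC := h.defect_nonneg N
  have hcs := real_inner_mul_inner_self_le e (∑ k ∈ N, S i k)
  rw [h.norm_ref, hB] at hcs
  have hN : (0 : ℝ) ≤ N.card := Nat.cast_nonneg _
  by_contra! hlt
  -- Dropping the defect, Cauchy–Schwarz reads `(b + 1) * (b - n) ≤ 0`, which fails for `b < -1`.
  nlinarith [mul_pos (show 0 < -1 - ⟪e, ∑ k ∈ N, S i k⟫ by linarith)
    (show 0 < N.card - ⟪e, ∑ k ∈ N, S i k⟫ by linarith)]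

/-- The tangent lines of the ellipse bounding the values on a star. -/
theorem tangent_bound [DecidableEq V] (h : IsSwapSystem e S) {i j : V} (hij : i ≠ j)
    {N : Finset V} (hi : i ∉ N) (hj : j ∉ N) {α γ : ℝ} (hγ1 : γ ≤ 1)
    (hαγ : 0 ≤ α + γ) (hα : 0 < 1 + α)
    (hcirc : γ ^ 2 * (((N.card : ℝ) + 1) ^ 2 - 1) = 1 - α ^ 2) :
    0 ≤ 1 + α * ⟪e, S i j⟫
      + γ * (⟪e, S i j⟫ + 2 * ⟪e, ∑ k ∈ N, S i k⟫ - (N.card - 1)) := by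
  have hee := h.norm_ref
  have hAA := h.norm_swap i j hij
  have hBB := h.inner_star_self hi
  have hDD := h.inner_star_self hj
  have hAB := h.inner_swap_star hij hi hj
  have hAD := h.inner_swap_star hij.symm hj hi
  rw [h.symm j i] at hAD
  have hC := h.defect_nonneg N
  set A := S i j
  set B := ∑ k ∈ N, S i k
  set D := ∑ k ∈ N, S j k
  set n : ℝ := (N.card : ℝ)
  set c := defect e S N
  -- This value of `s` cancels the terms of the certificate that involve `⟪e, D⟫`; `s ≤ 1` is
  -- equivalent to `0 ≤ α + γ`.
  set s := (1 - γ) / (1 + α)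
  have hs : s * (1 + α) = 1 - γ := div_mul_cancel₀ _ hα.ne'
  have hs0 : 0 ≤ s := div_nonneg (by linarith) hα.le
  have hs1 : s ≤ 1 := (div_le_one hα).mpr (by linarith)
  set W := A + B + D - (n - 1) • e with hW
  set Q := e + α • A + γ • (B - D) + (s * γ) • W with hQ
  have hWW : 0 ≤ ⟪W, W⟫ := real_inner_self_nonneg
  have hQQ : 0 ≤ ⟪Q, Q⟫ := real_inner_self_nonneg
  have hWexp : ⟪W, W⟫ = ⟪A, A⟫ + ⟪B, B⟫ + ⟪D, D⟫ + (n - 1) ^ 2 * ⟪e, e⟫ + 2 * ⟪A, B⟫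
      + 2 * ⟪A, D⟫ + 2 * ⟪B, D⟫ - 2 * (n - 1) * (⟪e, A⟫ + ⟪e, B⟫ + ⟪e, D⟫) := by
    simp only [hW, inner_add_left, inner_add_right, inner_sub_left, inner_sub_right,
      real_inner_smul_left, real_inner_smul_right, real_inner_comm A e, real_inner_comm B e,
      real_inner_comm D e, real_inner_comm A B, real_inner_comm A D, real_inner_comm B D]
    ring
  have hQexp : ⟪Q, Q⟫ = ⟪e, e⟫ + α ^ 2 * ⟪A, A⟫
      + γ ^ 2 * (⟪B, B⟫ + ⟪D, D⟫ - 2 * ⟪B, D⟫) + (s * γ) ^ 2 * ⟪W, W⟫ + 2 * α * ⟪e, A⟫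
      + 2 * γ * (⟪e, B⟫ - ⟪e, D⟫) + 2 * α * γ * (⟪A, B⟫ - ⟪A, D⟫)
      + 2 * (s * γ) * (⟪e, A⟫ + ⟪e, B⟫ + ⟪e, D⟫ - (n - 1) * ⟪e, e⟫)
      + 2 * α * (s * γ) * (⟪A, A⟫ + ⟪A, B⟫ + ⟪A, D⟫ - (n - 1) * ⟪e, A⟫)
      + 2 * γ * (s * γ) * (⟪A, B⟫ - ⟪A, D⟫ + ⟪B, B⟫ - ⟪D, D⟫
        - (n - 1) * (⟪e, B⟫ - ⟪e, D⟫)) := by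
    simp only [hQ, hW, inner_add_left, inner_add_right, inner_sub_left, inner_sub_right,
      real_inner_smul_left, real_inner_smul_right, real_inner_comm A e, real_inner_comm B e,
      real_inner_comm D e, real_inner_comm A B, real_inner_comm A D, real_inner_comm B D]
    ring
  have hAB' : ⟪A, B⟫ = (n * (⟪e, A⟫ - 1) + ⟪e, B⟫ + ⟪e, D⟫) / 2 := by linarith
  have hAD' : ⟪A, D⟫ = (n * (⟪e, A⟫ - 1) + ⟪e, B⟫ + ⟪e, D⟫) / 2 := by linarith
  -- The inner product `⟪B, D⟫` is not determined by the swap relations. The weight `γ ^ 2 * (1 - s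
  -- ^ 2)` of the second square makes it cancel.
  have hid : 2 * (1 + α * ⟪e, A⟫ + γ * (⟪e, A⟫ + 2 * ⟪e, B⟫ - (n - 1))) =
      ⟪Q, Q⟫ + γ ^ 2 * (1 - s ^ 2) * ⟪W, W⟫ + 4 * γ ^ 2 * c := by
    rw [hQexp, hWexp, hee, hAA, hBB, hDD, hAB', hAD']
    linear_combination hcirc * (-1) - 2 * γ * (⟪e, A⟫ + ⟪e, B⟫ + ⟪e, D⟫ - (n - 1)) * hs
  have : 0 ≤ γ ^ 2 * (1 - s ^ 2) * ⟪W, W⟫ :=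
    mul_nonneg (mul_nonneg (sq_nonneg _) (by nlinarith)) hWW
  nlinarith [mul_nonneg (sq_nonneg γ) hC]

/-- If the swap `S i j` has value `-1`, the values on the rest of the star are determined. -/
theorem inner_star_of_inner_eq_neg_one (h : IsSwapSystem e S) {i j : V}
    (hij : i ≠ j) {N : Finset V} (hi : i ∉ N) (hj : j ∉ N) (ha : ⟪e, S i j⟫ = -1) :
    2 * ⟪e, ∑ k ∈ N, S i k⟫ = N.card := by
  have hAB := h.inner_swap_star hij hi hj
  have hAD := h.inner_swap_star hij.symm hj hi
  rw [h.symm j i] at hAD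
  -- Equality in Cauchy–Schwarz: two unit vectors with inner product `-1` are opposite.
  have h0 : e + S i j = 0 := by
    rw [← inner_self_eq_zero (𝕜 := ℝ), inner_add_left, inner_add_right, inner_add_right,
      h.norm_ref, h.norm_swap i j hij, real_inner_comm e (S i j), ha]
    norm_num
  rw [← neg_eq_of_add_eq_zero_right h0] at hAB hAD
  simp only [inner_neg_left, inner_neg_right, h.norm_ref] at hAB hAD
  linarith

/-- The nonlinear monogamy bound for a swap system. -/
theorem star_bound [DecidableEq V] (h : IsSwapSystem e S) {i j : V} (hij : i ≠ j)
    {N : Finset V} (hi : i ∉ N) (hj : j ∉ N) (hN : 0 < N.card) {d g : ℝ}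
    (hd : d = N.card + 1) (hg : g = -⟪e, S i j⟫) :
    -1 ≤ g ∧ g ≤ 1 ∧ -⟪e, ∑ k ∈ N, S i k⟫ ≤
      if g < -1 / d then 1
      else (1 / 2) * (2 - d - g + Real.sqrt ((d ^ 2 - 1) * (1 - g ^ 2))) := by
  have habs := abs_le.mp (h.abs_inner_le_one hij)
  have hn : (1 : ℝ) ≤ N.card := by exact_mod_cast hN
  have hd2 : 2 ≤ d := by linarith
  refine ⟨by linarith, by linarith, ?_⟩
  split_ifs with hlt
  · linarith [h.neg_one_le_inner_star hi]
  rw [not_lt, div_le_iff₀ (by linarith)] at hlt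
  -- At `g = 1` the tangent is vertical (`γ = 0`) and says nothing about `b`, so this endpoint is
  -- handled separately.
  rcases eq_or_lt_of_le (show g ≤ 1 by linarith) with hg1 | hg1
  · have := h.inner_star_of_inner_eq_neg_one hij hi hj (by linarith)
    rw [hg1]
    norm_num
    linarith
  have hgm : 0 < 1 + g := by nlinarith
  have hD : 0 < d ^ 2 - 1 := by nlinarith
  have hsq : 0 < 1 - g ^ 2 := by nlinarith
  -- With `α = g`, this is the slope coefficient of the tangent at the lower point of the ellipse
  -- where `a = -g`.
  set γ := Real.sqrt ((1 - g ^ 2) / (d ^ 2 - 1)) with hγ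
  have hγ0 : 0 < γ := Real.sqrt_pos.mpr (div_pos hsq hD)
  have hγ2 : γ ^ 2 * (d ^ 2 - 1) = 1 - g ^ 2 := by
    rw [hγ, Real.sq_sqrt (div_pos hsq hD).le, div_mul_cancel₀ _ hD.ne']
  have hroot : Real.sqrt ((d ^ 2 - 1) * (1 - g ^ 2)) = γ * (d ^ 2 - 1) := by
    rw [← hγ2, show (d ^ 2 - 1) * (γ ^ 2 * (d ^ 2 - 1)) = (γ * (d ^ 2 - 1)) ^ 2 by ring,
      Real.sqrt_sq (by positivity)]
  have hγ1 : γ ≤ 1 := by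
    by_contra! hc
    nlinarith [mul_pos (show 0 < γ ^ 2 - 1 by nlinarith) hD, sq_nonneg g]
  -- If `g < -γ`, then `γ ^ 2 < g ^ 2` forces `(d * g) ^ 2 > 1`, against `-1/d ≤ g < 0`.
  have hgγ : 0 ≤ g + γ := by
    by_contra! hc
    have h1 : γ ^ 2 < g ^ 2 := by nlinarith
    have h2 : (d * g) ^ 2 ≤ 1 := by
      rw [sq_le_one_iff_abs_le_one, abs_le]
      constructor <;> nlinarith
    nlinarith
  have ht := h.tangent_bound hij hi hj hγ1 hgγ hgm (by rw [← hd]; exact hγ2)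
  rw [hroot]
  have ha : ⟪e, S i j⟫ = -g := by linarith
  have hnc : (N.card : ℝ) = d - 1 := by linarith
  rw [ha, hnc] at ht
  have hfac : 0 ≤ γ * (γ * (d ^ 2 - 1) - g + 2 * ⟪e, ∑ k ∈ N, S i k⟫ - (d - 2)) := by
    linarith [hγ2]
  linarith [nonneg_of_mul_nonneg_right hfac hγ0]

end IsSwapSystem

/-! ### Products of Pauli strings -/

theorem qubitTensor_eq_prod_smul {V : Type*} [Fintype V] {M N : V → Matrix (Fin 2) (Fin 2) ℂ}
    {z : V → ℂ} (h : ∀ v, M v = z v • N v) : qubitTensor M = (∏ v, z v) • qubitTensor N := by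
  ext x y
  simp [qubitTensor, h, Finset.prod_mul_distrib]

theorem PauliLabel.mat_I : PauliLabel.I.mat = 1 := by
  ext p q
  fin_cases p <;> fin_cases q <;> simp [PauliLabel.mat]

theorem PauliLabel.mat_mul_self (a : PauliLabel) : a.mat * a.mat = 1 := by
  cases a <;> ext p q <;> fin_cases p <;> fin_cases q <;> simp [PauliLabel.mat]

theorem PauliLabel.mat_anticomm {a b : PauliLabel} (ha : a ≠ .I) (hb : b ≠ .I) (hab : a ≠ b) :
    a.mat * b.mat = (-1 : ℂ) • (b.mat * a.mat) := by
  cases a <;> cases b <;> simp_all [PauliLabel.mat]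

theorem PauliLabel.exists_mat_mul {a b c : PauliLabel} (ha : a ≠ .I) (hb : b ≠ .I) (hc : c ≠ .I)
    (hab : a ≠ b) (hac : a ≠ c) (hbc : b ≠ c) :
    ∃ z : ℂ, z * z = -1 ∧ a.mat * b.mat = z • c.mat := by
  cases a <;> cases b <;> cases c <;> try contradiction
  case X.Y.Z | Y.Z.X | Z.X.Y => exact ⟨Complex.I, by simp, by simp [PauliLabel.mat]⟩
  case Y.X.Z | Z.Y.X | X.Z.Y => exact ⟨-Complex.I, by simp, by simp [PauliLabel.mat]⟩

/-- The Pauli string with label `p` on the two qubits `a` and `b`. -/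
def pairString {V : Type*} [DecidableEq V] (p : PauliLabel) (a b : V) : V → PauliLabel :=
  fun v => if v = a ∨ v = b then p else .I

theorem pairString_comm {V : Type*} [DecidableEq V] (p : PauliLabel) (a b : V) : pairString p a b = pairString p b a := by
  funext v
  simp only [pairString, or_comm]

section

variable {V : Type*} [Fintype V]

theorem pauliOp_I : pauliOp (fun _ : V => PauliLabel.I) = 1 := by
  ext x y
  simp only [pauliOp, qubitTensor, PauliLabel.mat_I, Matrix.of_apply, Matrix.one_apply]
  by_cases h : x = y
  · simp [h]
  · obtain ⟨v, hv⟩ := Function.ne_iff.mp h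
    rw [if_neg h]
    exact Finset.prod_eq_zero (Finset.mem_univ v) (if_neg hv)

variable [DecidableEq V]

theorem pauliOp_mul_self (s : V → PauliLabel) : pauliOp s * pauliOp s = 1 := by
  rw [← pauliOp_I, pauliOp, pauliOp, qubitTensor_mul]
  simp only [PauliLabel.mat_mul_self, PauliLabel.mat_I]

theorem pauliOp_mul_comm_of_isHermitian {s t : V → PauliLabel}
    (h : (pauliOp s * pauliOp t).IsHermitian) : pauliOp s * pauliOp t = pauliOp t * pauliOp s := by
  have := h.eq
  rwa [Matrix.conjTranspose_mul, (pauliOp_isHermitian s).eq, (pauliOp_isHermitian t).eq,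
    eq_comm] at this

/-- A Hermitian product of Hermitian factors commutes; together with anticommutation it would
vanish, although Pauli strings are invertible. -/
theorem not_isHermitian_of_anticomm {s t : V → PauliLabel}
    (h : pauliOp s * pauliOp t = -(pauliOp t * pauliOp s)) :
    ¬ (pauliOp s * pauliOp t).IsHermitian := by
  intro hH
  have h0 : pauliOp s * pauliOp t = 0 := by
    rw [← pauliOp_mul_comm_of_isHermitian hH] at h
    ext x y
    exact self_eq_neg.mp (congrFun (congrFun h x) y)
  have h1 : pauliOp s * (pauliOp s * pauliOp t) * pauliOp t = 1 := by
    rw [← mul_assoc, pauliOp_mul_self, one_mul, pauliOp_mul_self]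
  rw [h0, mul_zero, zero_mul] at h1
  exact zero_ne_one h1

theorem siteOp_mul_siteOp (p : PauliLabel) {a b : V} (hab : a ≠ b) :
    siteOp p a * siteOp p b = pauliOp (pairString p a b) := by
  simp only [siteOp, pauliOp, qubitTensor_mul]
  congr 1
  funext v
  simp only [Function.update_apply, pairString]
  by_cases h1 : v = a
  · simp [h1, hab, PauliLabel.mat_I]
  · by_cases h2 : v = b <;> simp [h1, h2, hab.symm, PauliLabel.mat_I]

theorem pairString_mul_adjacent (p : PauliLabel) {a b c : V} (hab : a ≠ b) (hac : a ≠ c)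
    (hbc : b ≠ c) :
    pauliOp (pairString p a b) * pauliOp (pairString p a c) = pauliOp (pairString p b c) := by
  rw [pauliOp, pauliOp, qubitTensor_mul, pauliOp]
  congr 1
  funext v
  simp only [pairString]
  by_cases h1 : v = a
  · simp [h1, hab, hac, PauliLabel.mat_I, PauliLabel.mat_mul_self]
  · by_cases h2 : v = b
    · simp [h2, hab.symm, hbc, PauliLabel.mat_I]
    · by_cases h3 : v = c <;> simp [h1, h2, h3, hac.symm, hbc.symm, PauliLabel.mat_I]

/-- Only at the site `a` are both factors non-identity, so exactly one sign is picked up. -/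
theorem pairString_anticomm {p q : PauliLabel} (hp : p ≠ .I) (hq : q ≠ .I) (hpq : p ≠ q)
    {a b c : V} (hab : a ≠ b) (hbc : b ≠ c) :
    pauliOp (pairString p a b) * pauliOp (pairString q a c) =
      -(pauliOp (pairString q a c) * pauliOp (pairString p a b)) := by
  simp only [pauliOp, qubitTensor_mul]
  rw [qubitTensor_eq_prod_smul (z := fun v => if v = a then -1 else 1)
    (N := fun v => (pairString q a c v).mat * (pairString p a b v).mat)]
  · simp
  · intro v
    simp only [pairString]
    by_cases h1 : v = a
    · simpa [h1] using PauliLabel.mat_anticomm hp hq hpq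
    · by_cases h2 : v = b
      · simp [h2, hab.symm, hbc, PauliLabel.mat_I]
      · simp [h1, h2, PauliLabel.mat_I]

/-- Each of the two sites contributes the same phase, `i` or `-i`, whose square is `-1`. -/
theorem pairString_mul_same {p q r : PauliLabel} (hp : p ≠ .I) (hq : q ≠ .I) (hr : r ≠ .I)
    (hpq : p ≠ q) (hpr : p ≠ r) (hqr : q ≠ r) {a b : V} (hab : a ≠ b) :
    pauliOp (pairString p a b) * pauliOp (pairString q a b) = -pauliOp (pairString r a b) := by
  obtain ⟨z, hz, hm⟩ := PauliLabel.exists_mat_mul hp hq hr hpq hpr hqr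
  simp only [pauliOp, qubitTensor_mul]
  rw [qubitTensor_eq_prod_smul (z := fun v => if v = a ∨ v = b then z else 1)
    (N := fun v => (pairString r a b v).mat)]
  · have hprod : ∏ v, (if v = a ∨ v = b then z else 1) = -1 := by
      rw [← hz, Finset.prod_eq_mul a b hab (fun v _ hv => if_neg (by tauto)) (by simp) (by simp)]
      simp
    rw [hprod, neg_one_smul]
  · intro v
    simp only [pairString]
    by_cases h1 : v = a ∨ v = b <;> simp [h1, hm, PauliLabel.mat_I]

/-- The monomial of a Pauli label on two qubits. -/
def pairMonomial {k : ℕ} (hk : 2 ≤ k) (p : PauliLabel) (a b : V) : PauliMonomial V k :=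
  ⟨pairString p a b, (Finset.card_le_card (t := {a, b}) fun v hv => by
    by_contra h
    simp_all [pairString]).trans (Finset.card_le_two.trans hk)⟩

/-- The identity monomial. -/
def oneMonomial (V : Type*) [Fintype V] (k : ℕ) : PauliMonomial V k :=
  ⟨fun _ => .I, by simp⟩

/-! ### Swap systems inside moment matrices -/

namespace IsMomentMatrix

variable {k : ℕ} {Γ : Matrix (PauliMonomial V k) (PauliMonomial V k) ℝ}

theorem pair_adjacent (h : IsMomentMatrix Γ) (hk : 2 ≤ k) (p : PauliLabel) {a b c : V}
    (hab : a ≠ b) (hac : a ≠ c) (hbc : b ≠ c) :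
    Γ (pairMonomial hk p a b) (pairMonomial hk p a c) =
      Γ (oneMonomial V k) (pairMonomial hk p b c) := by
  apply h.eq_of_mul_eq
  simp only [pairMonomial, oneMonomial, pauliOp_I, one_mul]
  exact pairString_mul_adjacent p hab hac hbc

theorem pair_adjacent_of_ne (h : IsMomentMatrix Γ) (hk : 2 ≤ k) {p q : PauliLabel} (hp : p ≠ .I)
    (hq : q ≠ .I) (hpq : p ≠ q) {a b c : V} (hab : a ≠ b) (hbc : b ≠ c) :
    Γ (pairMonomial hk p a b) (pairMonomial hk q a c) = 0 :=
  h.eq_zero _ _ (not_isHermitian_of_anticomm (pairString_anticomm hp hq hpq hab hbc))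

theorem pair_same (h : IsMomentMatrix Γ) (hk : 2 ≤ k) {p q r : PauliLabel} (hp : p ≠ .I)
    (hq : q ≠ .I) (hr : r ≠ .I) (hpq : p ≠ q) (hpr : p ≠ r) (hqr : q ≠ r) {a b : V}
    (hab : a ≠ b) :
    Γ (pairMonomial hk p a b) (pairMonomial hk q a b) =
      -Γ (oneMonomial V k) (pairMonomial hk r a b) := by
  apply h.eq_neg_of_mul_eq_neg
  simp only [pairMonomial, oneMonomial, pauliOp_I, one_mul]
  exact pairString_mul_same hp hq hr hpq hpr hqr hab

theorem pseudoExpectation_siteOp_mul (h : IsMomentMatrix Γ) (hk : 2 ≤ k) (p : PauliLabel)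
    {a b : V} (hab : a ≠ b) :
    pseudoExpectation Γ (siteOp p a * siteOp p b) =
      Γ (oneMonomial V k) (pairMonomial hk p a b) := by
  rw [siteOp_mul_siteOp p hab]
  apply pseudoExpectation_eq h
  · exact Submodule.subset_span ⟨⟨_, (pairMonomial hk p a b).2.trans (by omega)⟩, rfl⟩
  · simp [pairMonomial, oneMonomial, pauliOp_I]

open scoped RealInnerProductSpace MatrixOrder in
theorem exists_gram (h : IsMomentMatrix Γ) :
    ∃ x : PauliMonomial V k → EuclideanSpace ℝ (PauliMonomial V k), ∀ A B, ⟪x A, x B⟫ = Γ A B := by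
  obtain ⟨M, hM⟩ : ∃ M : Matrix (PauliMonomial V k) (PauliMonomial V k) ℝ,
      Γ = Matrix.conjTranspose M * M :=
    CStarAlgebra.nonneg_iff_eq_star_mul_self.mp (Matrix.nonneg_iff_posSemidef.mpr h.posSemidef)
  refine ⟨fun A => WithLp.toLp 2 fun C => M C A, fun A B => ?_⟩
  rw [hM, PiLp.inner_apply, Matrix.mul_apply]
  refine Finset.sum_congr rfl fun C _ => ?_
  simp [mul_comm]

open scoped RealInnerProductSpace in
/-- After a rotation by `Y` at the qubit `i`, the Gram vectors of a moment matrix contain a swap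
system, whose values on the star of `i` are the negatives of the edge values. -/
theorem exists_swapSystem (h : IsMomentMatrix Γ) (hk : 2 ≤ k) (i : V) :
    ∃ (e : EuclideanSpace ℝ (PauliMonomial V k)) (S : V → V → EuclideanSpace ℝ (PauliMonomial V k)),
      IsSwapSystem e S ∧ ∀ a, i ≠ a → momentValue Γ i a = -⟪e, S i a⟫ := by
  obtain ⟨x, hx⟩ := h.exists_gram
  set o := oneMonomial V k with ho
  set m : PauliLabel → V → V → PauliMonomial V k := pairMonomial hk with hm
  -- Conjugation by `Y` at `i` negates `X` and `Z` there and fixes `Y`.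
  set ε : V → ℝ := fun v => if v = i then -1 else 1 with hε
  have hεsq : ∀ v, ε v * ε v = 1 := by
    intro v
    simp only [hε]
    split_ifs <;> norm_num
  -- The vector of the rotated swap `(I + XX + YY + ZZ) / 2`.
  set S : V → V → EuclideanSpace ℝ (PauliMonomial V k) := fun a b =>
    (1 / 2 : ℝ) • (x o + (ε a * ε b) • (x (m .X a b) + x (m .Z a b)) + x (m .Y a b)) with hS
  have hsym : ∀ A B, Γ A B = Γ B A := fun A B => by
    rw [← hx, ← hx, real_inner_comm]
  have heS : ∀ a b, ⟪x o, S a b⟫ =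
      (1 / 2) * (1 + ε a * ε b * (Γ o (m .X a b) + Γ o (m .Z a b)) + Γ o (m .Y a b)) := by
    intro a b
    simp only [hS, inner_add_right, real_inner_smul_right, hx, h.diag]
  refine ⟨x o, S, ⟨by rw [hx, h.diag], ?_, ?_, ?_⟩, ?_⟩
  · intro a b
    simp only [hS, hm, pairMonomial, pairString_comm _ a b, mul_comm (ε a)]
  · intro a b hab
    have hXY : Γ (m .X a b) (m .Y a b) = -Γ o (m .Z a b) :=
      h.pair_same hk (by simp) (by simp) (by simp) (by simp) (by simp) (by simp) hab
    have hXZ : Γ (m .X a b) (m .Z a b) = -Γ o (m .Y a b) :=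
      h.pair_same hk (by simp) (by simp) (by simp) (by simp) (by simp) (by simp) hab
    have hYZ : Γ (m .Y a b) (m .Z a b) = -Γ o (m .X a b) :=
      h.pair_same hk (by simp) (by simp) (by simp) (by simp) (by simp) (by simp) hab
    have hsq : (ε a * ε b) * (ε a * ε b) = 1 := by
      linear_combination ε b * ε b * hεsq a + hεsq b
    simp only [hS, inner_add_right, inner_add_left, real_inner_smul_right, real_inner_smul_left,
      hx, h.diag, hsym _ o, hsym (m .Y a b) (m .X a b), hsym (m .Z a b), hXY, hXZ, hYZ]
    -- The cross terms with the identity cancel those between different labels, leaving four unit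
    -- squares with weight `1/4`.
    linear_combination (1 / 2 - (1 / 2) * Γ o (m .Y a b)) * hsq
  · intro a b c hab hac hbc
    have hadj : ∀ p, Γ (m p a b) (m p a c) = Γ o (m p b c) := fun p =>
      h.pair_adjacent hk p hab hac hbc
    have hadj0 : ∀ p q, p ≠ .I → q ≠ .I → p ≠ q → Γ (m p a b) (m q a c) = 0 :=
      fun p q hp hq hpq => h.pair_adjacent_of_ne hk hp hq hpq hab hbc
    rw [heS, heS, heS]
    simp only [hS, inner_add_right, inner_add_left, real_inner_smul_right, real_inner_smul_left,
      hx, h.diag, hsym _ o, hadj]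
    -- The six products of different labels anticommute, so their moments vanish; equal labels
    -- multiply to the pair on `b, c`.
    rw [hadj0 .X .Y, hadj0 .X .Z, hadj0 .Y .X, hadj0 .Y .Z, hadj0 .Z .X, hadj0 .Z .Y] <;>
      try simp
    linear_combination (1 / 2) * (ε b * ε c * (Γ o (m .X b c) + Γ o (m .Z b c))) * hεsq a
  · intro a hia
    rw [heS, momentValue, h.pseudoExpectation_siteOp_mul hk _ hia,
      h.pseudoExpectation_siteOp_mul hk _ hia, h.pseudoExpectation_siteOp_mul hk _ hia]
    -- On an edge at `i` the sign `ε i * ε a` is `-1`, which turns the swap value into `-g`.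
    simp only [hε, if_true, if_neg hia.symm]
    ring

theorem starMonogamyBound (h : IsMomentMatrix Γ) (hk : 2 ≤ k) (G : SimpleGraph V)
    [DecidableRel G.Adj] {i j : V} (hd : 2 ≤ G.degree i) (hij : G.Adj i j) :
    StarMonogamyBound G (momentValue Γ) i j := by
  obtain ⟨e, S, hS, hval⟩ := h.exists_swapSystem hk i
  have hcard : ((G.neighborFinset i).erase j).card + 1 = G.degree i := by
    rw [Finset.card_erase_add_one (by simpa using hij), G.card_neighborFinset_eq_degree]
  have hsum : ∑ a ∈ (G.neighborFinset i).erase j, momentValue Γ i a =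
      -inner ℝ e (∑ a ∈ (G.neighborFinset i).erase j, S i a) := by
    rw [inner_sum, ← Finset.sum_neg_distrib]
    refine Finset.sum_congr rfl fun a ha => hval a ?_
    have : G.Adj i a := by simpa using Finset.mem_of_mem_erase ha
    exact this.ne
  rw [StarMonogamyBound, hsum]
  exact hS.star_bound hij.ne (by simp) (by simp) (by omega) (by exact_mod_cast hcard.symm)
    (hval j hij.ne)

end IsMomentMatrix

/-! ### Moment matrices of states -/

/-- The real part of the expectation of an operator in the state `ψ`. -/
noncomputable def expectationRe (ψ : EuclideanSpace ℂ (V → Fin 2)) (C : QubitOp V) : ℝ :=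
  (star ψ.ofLp ⬝ᵥ C.mulVec ψ.ofLp).re

theorem expectationRe_neg (ψ : EuclideanSpace ℂ (V → Fin 2)) (C : QubitOp V) :
    expectationRe ψ (-C) = -expectationRe ψ C := by
  simp [expectationRe, Matrix.neg_mulVec]

theorem expectationRe_add (ψ : EuclideanSpace ℂ (V → Fin 2)) (C D : QubitOp V) :
    expectationRe ψ (C + D) = expectationRe ψ C + expectationRe ψ D := by
  simp [expectationRe, Matrix.add_mulVec]

theorem expectationRe_smul (ψ : EuclideanSpace ℂ (V → Fin 2)) (r : ℝ) (C : QubitOp V) :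
    expectationRe ψ (r • C) = r * expectationRe ψ C := by
  simp [expectationRe, Matrix.smul_mulVec]

theorem expectationRe_one {ψ : EuclideanSpace ℂ (V → Fin 2)} (hψ : ‖ψ‖ = 1) :
    expectationRe ψ 1 = 1 := by
  have h1 : inner ℂ ψ ψ = 1 := by rw [inner_self_eq_norm_sq_to_K, hψ]; simp
  rw [EuclideanSpace.inner_eq_star_dotProduct, dotProduct_comm] at h1
  rw [expectationRe, Matrix.one_mulVec, h1, Complex.one_re]

theorem expectationRe_conjTranspose (ψ : EuclideanSpace ℂ (V → Fin 2)) (C : QubitOp V) :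
    expectationRe ψ C.conjTranspose = expectationRe ψ C := by
  have : star (star ψ.ofLp ⬝ᵥ C.mulVec ψ.ofLp) = star ψ.ofLp ⬝ᵥ C.conjTranspose.mulVec ψ.ofLp := by
    rw [← Matrix.star_dotProduct, Matrix.star_mulVec, ← Matrix.dotProduct_mulVec]
  rw [expectationRe, ← this, expectationRe, RCLike.star_def, Complex.conj_re]

/-- The level-`k` moment matrix of a state. -/
noncomputable def stateMoment (ψ : EuclideanSpace ℂ (V → Fin 2)) (k : ℕ) :
    Matrix (PauliMonomial V k) (PauliMonomial V k) ℝ :=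
  Matrix.of fun A B => expectationRe ψ (pauliOp A.1 * pauliOp B.1)

open scoped ComplexOrder in
theorem expectationRe_conjTranspose_mul_self_nonneg (ψ : EuclideanSpace ℂ (V → Fin 2))
    (C : QubitOp V) : 0 ≤ expectationRe ψ (C.conjTranspose * C) := by
  rw [expectationRe, ← Matrix.mulVec_mulVec, Matrix.dotProduct_mulVec, ← Matrix.star_mulVec]
  exact (Complex.le_def.mp (dotProduct_star_self_nonneg (C.mulVec ψ.ofLp))).1

/-- Real combinations of Pauli strings are Hermitian, so positivity is that of the expectation of a
square. Taking real parts gives symmetry and kills anti-Hermitian products. -/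
theorem isMomentMatrix_stateMoment {ψ : EuclideanSpace ℂ (V → Fin 2)} (hψ : ‖ψ‖ = 1) (k : ℕ) :
    IsMomentMatrix (stateMoment ψ k) where
  posSemidef := by
    let φ : QubitOp V →ₗ[ℝ] ℝ :=
      { toFun := expectationRe ψ
        map_add' := expectationRe_add ψ
        map_smul' := expectationRe_smul ψ }
    refine Matrix.PosSemidef.of_dotProduct_mulVec_nonneg ?_ fun c => ?_
    · ext A B
      rw [Matrix.conjTranspose_apply, star_trivial, stateMoment, Matrix.of_apply, Matrix.of_apply,
        ← expectationRe_conjTranspose, Matrix.conjTranspose_mul, (pauliOp_isHermitian _).eq,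
        (pauliOp_isHermitian _).eq]
    · have h0 := expectationRe_conjTranspose_mul_self_nonneg ψ (∑ A, c A • pauliOp A.1)
      have h1 : (∑ A, c A • pauliOp A.1).conjTranspose = ∑ A, c A • pauliOp A.1 := by
        rw [Matrix.conjTranspose_sum]
        exact Finset.sum_congr rfl fun A _ => by
          rw [Matrix.conjTranspose_smul, (pauliOp_isHermitian _).eq, star_trivial]
      have h2 : expectationRe ψ ((∑ A, c A • pauliOp A.1) * ∑ A, c A • pauliOp A.1) =
          star c ⬝ᵥ (stateMoment ψ k).mulVec c := by
        change φ _ = _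
        rw [Finset.sum_mul_sum, map_sum]
        simp only [map_sum, dotProduct, Matrix.mulVec, Finset.mul_sum, smul_mul_smul_comm,
          map_smul, smul_eq_mul]
        refine Finset.sum_congr rfl fun A _ => Finset.sum_congr rfl fun B _ => ?_
        change c A * c B * expectationRe ψ _ = c A * (expectationRe ψ _ * c B)
        ring
      rw [h1] at h0
      exact h0.trans_eq h2
  eq_of_mul_eq A B A' B' h := by simp only [stateMoment, Matrix.of_apply, h]
  eq_neg_of_mul_eq_neg A B A' B' h := by
    simp only [stateMoment, Matrix.of_apply, h, expectationRe_neg]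
  eq_zero A B h := by
    obtain ⟨P, z, hz, hz4⟩ := exists_pauliOp_mul A B
    have hstar : (pauliOp A.1 * pauliOp B.1).conjTranspose = star z • pauliOp P.1 := by
      rw [hz, Matrix.conjTranspose_smul, (pauliOp_isHermitian _).eq]
    -- The phase is a fourth root of unity, and `z = 1` or `z = -1` would make the product
    -- Hermitian.
    have hsq : z ^ 2 = -1 := by
      have hfac : (z - 1) * (z + 1) * (z ^ 2 + 1) = 0 := by linear_combination hz4
      rcases mul_eq_zero.mp hfac with h' | h'
      · refine absurd ?_ h
        rw [Matrix.IsHermitian, hstar, hz]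
        rcases mul_eq_zero.mp h' with h' | h'
        · rw [sub_eq_zero.mp h', star_one]
        · rw [eq_neg_of_add_eq_zero_left h', star_neg, star_one]
      · exact eq_neg_of_add_eq_zero_left h'
    have hneg : star z = -z := by
      have hfac : (z - Complex.I) * (z + Complex.I) = 0 := by
        linear_combination hsq - Complex.I_sq
      rcases mul_eq_zero.mp hfac with h' | h'
      · rw [sub_eq_zero.mp h', RCLike.star_def, Complex.conj_I]
      · rw [eq_neg_of_add_eq_zero_left h', star_neg, RCLike.star_def, Complex.conj_I]
    have := expectationRe_conjTranspose ψ (pauliOp A.1 * pauliOp B.1)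
    rw [hstar, hneg, neg_smul, ← hz, expectationRe_neg] at this
    rw [stateMoment, Matrix.of_apply]
    linarith
  diag A := by
    simp only [stateMoment, Matrix.of_apply, pauliOp_mul_self, expectationRe_one hψ]

/-- This transfers the bound from moment matrices to states; level 2 suffices because only two-qubit
strings occur. -/
theorem stateValue_eq_momentValue {ψ : EuclideanSpace ℂ (V → Fin 2)} (hψ : ‖ψ‖ = 1) {k : ℕ}
    (hk : 2 ≤ k) {a b : V} (hab : a ≠ b) :
    stateValue ψ a b = momentValue (stateMoment ψ k) a b := by
  have hval : ∀ p, pseudoExpectation (stateMoment ψ k) (siteOp p a * siteOp p b) =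
      expectationRe ψ (siteOp p a * siteOp p b) := by
    intro p
    rw [(isMomentMatrix_stateMoment hψ k).pseudoExpectation_siteOp_mul hk p hab,
      siteOp_mul_siteOp p hab]
    simp [stateMoment, oneMonomial, pairMonomial, pauliOp_I]
  change expectationRe ψ (eprTerm a b) - 1 = _
  rw [momentValue, hval, hval, hval, eprTerm, expectationRe_smul, expectationRe_add,
    sub_eq_add_neg (1 + _), expectationRe_add, expectationRe_add, expectationRe_neg,
    expectationRe_one hψ]
  ring

end

theorem mainTheorem2 {V : Type*} [Fintype V] [DecidableEq V] (G : SimpleGraph V)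
    [DecidableRel G.Adj] (w : Sym2 V → ℝ) (hw : ∀ e ∈ G.edgeSet, 0 < w e)
    (i j : V) (hd : 2 ≤ G.degree i) (hij : G.Adj i j) :
    (∀ ψ : EuclideanSpace ℂ (V → Fin 2), ‖ψ‖ = 1 → StarMonogamyBound G (stateValue ψ) i j) ∧
    (∀ k : ℕ, 2 ≤ k → ∀ Γ : Matrix (PauliMonomial V k) (PauliMonomial V k) ℝ,
      IsMomentMatrix Γ → StarMonogamyBound G (momentValue Γ) i j) ∧
    (∀ k : ℕ, 2 ≤ k → ∀ Γ : Matrix (PauliMonomial V k) (PauliMonomial V k) ℝ,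
      IsMomentSoSSolution G w Γ → StarMonogamyBound G (momentValue Γ) i j) := by
  refine ⟨fun ψ hψ => ?_, fun k hk Γ hΓ => hΓ.starMonogamyBound hk G hd hij,
    fun k hk Γ hΓ => hΓ.1.starMonogamyBound hk G hd hij⟩
  have hval : ∀ a, i ≠ a → stateValue ψ i a = momentValue (stateMoment ψ 2) i a :=
    fun a ha => stateValue_eq_momentValue hψ le_rfl ha
  have hsum : ∑ a ∈ (G.neighborFinset i).erase j, stateValue ψ i a =
      ∑ a ∈ (G.neighborFinset i).erase j, momentValue (stateMoment ψ 2) i a := by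
    refine Finset.sum_congr rfl fun a ha => hval a ?_
    have : G.Adj i a := by simpa using Finset.mem_of_mem_erase ha
    exact this.ne
  have := (isMomentMatrix_stateMoment hψ 2).starMonogamyBound le_rfl G hd hij
  rwa [StarMonogamyBound, ← hsum, ← hval j hij.ne] at this
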